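/- Propositional formulas are built from a countable set of variables by the single connective $\to$. An iterative propositional calculus is a finite set $P$ of formulas (axioms), with two rules of inference: modus ponens ($A,\ A\to B\vdash B$) and superposition, given by the Mal'cev operations: from $A(v)$ and $B$ derive the formula $A(B)$, in which $B$ replaces every occurrence of the variable $v$ in $A$; and from $A$ derive any formula obtained from $A$ by renaming (possibly identifying) variables. We write $P\vdash A$ if $A$ is derivable from $P$ by these rules. The calculus is decidable if there is an algorithm which, given an arbitrary formula $A$, decides whether $P\vdash A$. Put $A\to_0 A:=A\to A$ and $A\to_{i}A:=(A\to_{i-1}A)\to A$ for $i\ge 1$. Fix an alphabet $\{a_1,\dots,a_m\}$ with $m\ge 2$, and distinct variables $x,y,p$. The code of a letter is $\overline{a_i}[F]:=F\to\bigl((p\to_i p)\to(p\to p)\bigr)$, and the code of a word $w=b_1\cdots b_n$ is $\overline{w}[F]:=\overline{b_1}[\overline{b_2}[\cdots\overline{b_n}[F]\cdots]]$. For a finite sequence $\Pi=((\alpha_1,\beta_1),\dots,(\alpha_\mu,\beta_\mu))$ of pairs of nonempty words (a Post correspondence instance), let $P_\Pi$ be the calculus with the axioms $$\overline{a_i}[x]\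 \ (1\le i\le m),\qquad \bigl(\overline{\alpha_j}[x]\to\overline{\beta_j}[y]\bigr)\to(x\to y)\ \ (1\le j\le\mu),\qquad \overline{a_i}[x]\to\overline{a_i}[x]\ \ (1\le i\le m).$$ Theorem. There is an undecidable iterative propositional calculus. More precisely, for every $m\ge 2$ there is a finite sequence $\Pi$ of pairs of nonempty words over an $m$-letter alphabet such that exactly three variables occur in the axioms of $P_\Pi$ and the calculus $P_\Pi$ is undecidable; moreover, there is also no algorithm deciding derivability from $P_\Pi$ when superposition is restricted to the single rule $A(v),B\vdash A(B)$ (no renaming of variables). -/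

import Mathlib

namespace IterCalc

/-- Implicational propositional formulas over the countable set of variables `var 0, var 1, …`. -/
inductive Formula : Type
  | var (n : ℕ) : Formula
  | imp (A B : Formula) : Formula
  deriving DecidableEq

namespace Formula

/-- Gödel numbering of formulas (a bijection with `ℕ`). -/
def toNat : Formula → ℕ
  | var n => 2 * n
  | imp A B => 2 * Nat.pair A.toNat B.toNat + 1

/-- The formula with a given Gödel number. -/
def ofNat (k : ℕ) : Formula :=
  if h : k % 2 = 0 then var (k / 2)
  else imp (ofNat (k / 2).unpair.1) (ofNat (k / 2).unpair.2)
termination_by k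
decreasing_by
  · have := Nat.unpair_left_le (k / 2); omega
  · have := Nat.unpair_right_le (k / 2); omega

theorem ofNat_toNat (A : Formula) : ofNat A.toNat = A := by
  induction A with
  | var n => rw [toNat, ofNat]; simp
  | imp A B ihA ihB =>
    have h2 : (2 * Nat.pair A.toNat B.toNat + 1) / 2 = Nat.pair A.toNat B.toNat := by omega
    have h1 : ¬ (2 * Nat.pair A.toNat B.toNat + 1) % 2 = 0 := by omega
    rw [toNat, ofNat, dif_neg h1, h2, Nat.unpair_pair, ihA, ihB]

theorem toNat_ofNat (k : ℕ) : (ofNat k).toNat = k := by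
  induction k using Nat.strong_induction_on with
  | _ k ih =>
    rw [ofNat]
    split_ifs with h
    · rw [toNat]; omega
    · have hl := Nat.unpair_left_le (k / 2)
      have hr := Nat.unpair_right_le (k / 2)
      rw [toNat, ih _ (by omega), ih _ (by omega), Nat.pair_unpair]; omega

/-- The Gödel numbering as an equivalence. -/
def equivNat : Formula ≃ ℕ where
  toFun := toNat
  invFun := ofNat
  left_inv := ofNat_toNat
  right_inv := toNat_ofNat

/-- Algorithms act on formulas through the Gödel numbering. -/
instance : Primcodable Formula := Primcodable.ofEquiv ℕ equivNat

/-- The variables occurring in a formula. -/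
def vars : Formula → Finset ℕ
  | var n => {n}
  | imp A B => A.vars ∪ B.vars

/-- Simultaneous substitution of formulas for variables. -/
def subst (σ : ℕ → Formula) : Formula → Formula
  | var n => σ n
  | imp A B => imp (A.subst σ) (B.subst σ)

/-- `A.replace v B` is `A(B)`: the formula `B` is put for every occurrence of the variable `v`. -/
def replace (A : Formula) (v : ℕ) (B : Formula) : Formula :=
  A.subst (Function.update var v B)

/-- Renaming (possibly with identification) of variables. -/
def rename (ρ : ℕ → ℕ) (A : Formula) : Formula :=
  A.subst fun n => var (ρ n)

end Formula

/-- An iterative propositional calculus over the signature `{→}` is given by its finite set of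
axioms; the rules of inference are fixed. -/
abbrev Calculus : Type := Finset Formula

/-- Derivability by modus ponens and superposition, where superposition is given by the Mal'cev
operations: permuting and identifying variables (`rename`), and composition `A(v), B ⊢ A(B)`
(`superpose`). -/
inductive Derivable (P : Calculus) : Formula → Prop
  | ax {A : Formula} (hA : A ∈ P) : Derivable P A
  | mp {A B : Formula} (hA : Derivable P A) (hAB : Derivable P (Formula.imp A B)) : Derivable P B
  | superpose {A B : Formula} (v : ℕ) (hA : Derivable P A) (hB : Derivable P B) :
      Derivable P (A.replace v B)
  | rename {A : Formula} (ρ : ℕ → ℕ) (hA : Derivable P A) : Derivable P (A.rename ρ)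

/-- Derivability by modus ponens and weak substitution `A(v), B ⊢ A(B)` alone. -/
inductive WeaklyDerivable (P : Calculus) : Formula → Prop
  | ax {A : Formula} (hA : A ∈ P) : WeaklyDerivable P A
  | mp {A B : Formula} (hA : WeaklyDerivable P A) (hAB : WeaklyDerivable P (Formula.imp A B)) :
      WeaklyDerivable P B
  | superpose {A B : Formula} (v : ℕ) (hA : WeaklyDerivable P A) (hB : WeaklyDerivable P B) :
      WeaklyDerivable P (A.replace v B)

/-- The variables occurring in the axioms of a calculus. -/
def Calculus.vars (P : Calculus) : Finset ℕ := P.biUnion Formula.vars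

/-- A calculus is decidable if some algorithm decides, for an arbitrary formula, whether it is
derivable. -/
def Calculus.IsDecidable (P : Calculus) : Prop := ComputablePred fun A : Formula => Derivable P A

/-- The same for derivability by modus ponens and weak substitution alone. -/
def Calculus.IsWeaklyDecidable (P : Calculus) : Prop :=
  ComputablePred fun A : Formula => WeaklyDerivable P A

/-- The variable `x`. -/
def x : Formula := Formula.var 0
/-- The variable `y`. -/
def y : Formula := Formula.var 1
/-- The variable `p`. -/
def p : Formula := Formula.var 2

/-- `arrow i A` is `A →ᵢ A`: `arrow 0 A` is `A → A`, `arrow 1 A` is `(A → A) → A`, and so on. -/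
def arrow : ℕ → Formula → Formula
  | 0, A => Formula.imp A A
  | i + 1, A => Formula.imp (arrow i A) A

/-- The code `F → ((p →ᵢ p) → (p → p))` of the `i`-th letter. The letters are the elements of
`Fin m`, so the `i`-th letter is the number `i - 1`. -/
def letterCode {m : ℕ} (a : Fin m) (F : Formula) : Formula :=
  Formula.imp F (Formula.imp (arrow (a.val + 1) p) (Formula.imp p p))

/-- The code of a word; the first letter is outermost, the empty word has code `F`. -/
def wordCode {m : ℕ} : List (Fin m) → Formula → Formula
  | [], F => F
  | a :: w, F => letterCode a (wordCode w F)

/-- A finite sequence of pairs of nonempty words in an alphabet with `m` letters. -/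
structure PostInstance (m : ℕ) where
  pairs : List (List (Fin m) × List (Fin m))
  nonempty : ∀ q ∈ pairs, q.1 ≠ [] ∧ q.2 ≠ []

/-- The calculus of a Post correspondence instance, with the axioms `a[x]` and `a[x] → a[x]` for
each letter `a`, and `(α[x] → β[y]) → (x → y)` for each pair `(α, β)` of the instance. -/
def PostInstance.calculus {m : ℕ} (I : PostInstance m) : Calculus :=
  (Finset.univ.image fun a : Fin m => letterCode a x) ∪
  (I.pairs.toFinset.image fun q =>
    Formula.imp (Formula.imp (wordCode q.1 x) (wordCode q.2 y)) (Formula.imp x y)) ∪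
  (Finset.univ.image fun a : Fin m => Formula.imp (letterCode a x) (letterCode a x))

end IterCalc

/-! A code is a chain of implications whose conclusions are marks `(A →ᵢ₊₁ A) → (A → A)`. Marks can
be read back, so codes behave like words. For nonempty `u`, `v` the implication from the code of `u`
to the code of `v`, both over `x`, is derivable iff some sequence of pairs put in front of `u` and
`v` makes them equal (`Joins`). One direction starts from `w[x] → w[x]` and strips pairs by modus
ponens. Only codes of nonempty words are substituted, and these are derivable, so weak substitution
suffices.

The converse rests on an invariant, `Admissible`, closed under substitution and modus ponens. The
critical step is modus ponens with an implication `A → B` obtained by stripping pairs. If first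
components never fall short of second ones (`NoOverhang`), then `B` is `A` with letters wrapped
around it, hence `A` itself or an instance of a letter axiom (`FormulaJoins.eq_codeAt`,
`Admissible.mp`).

It remains to find a finite system with `NoOverhang` for which joining a fixed word with a varying
one is undecidable. A Turing machine with undecidable halting problem is turned into a semi-Thue
system, and this into a Post system whose overhang is a queue that rotates through the current word;
stars guarantee `NoOverhang` (`joins_starPair_iff`, `noOverhang_starPair`). A prefix code brings the
alphabet down to two letters. -/

namespace IterCalc

/-! ### Post correspondence systems -/

/-- Some sequence of pairs of the system `S`, put in front of `u` and of `v`, gives equal words. -/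
def Joins {α : Type*} (S : Set (List α × List α)) (u v : List α) : Prop :=
  ∃ J : List (List α × List α), (∀ q ∈ J, q ∈ S) ∧
    J.flatMap Prod.fst ++ u = J.flatMap Prod.snd ++ v

/-- No concatenation of first components is a proper prefix of the corresponding concatenation of
second components. -/
def NoOverhang {α : Type*} (S : Set (List α × List α)) : Prop :=
  ∀ J : List (List α × List α), (∀ q ∈ J, q ∈ S) → ∀ u : List α,
    J.flatMap Prod.fst ++ u = J.flatMap Prod.snd → u = []

/-! ### Codes of words -/

namespace Formula

/-- The number of symbols of a formula. -/
def size : Formula → ℕ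
  | var _ => 1
  | imp A B => A.size + B.size + 1

theorem size_pos (A : Formula) : 0 < A.size := by
  cases A <;> simp [size]

end Formula

open Formula

theorem size_arrow (i : ℕ) (A : Formula) : (arrow i A).size = (i + 2) * A.size + (i + 1) := by
  induction i with
  | zero => simp [arrow, size]; ring
  | succ i ih => simp only [arrow, size, ih]; ring

theorem arrow_injective (A : Formula) : Function.Injective fun i => arrow i A := by
  intro i j h
  have h1 := congrArg size h
  simp only [size_arrow] at h1
  have := size_pos A
  by_contra hne
  rcases Nat.lt_or_gt_of_ne hne with h | h <;> nlinarith

theorem subst_arrow (σ : ℕ → Formula) (i : ℕ) (A : Formula) :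
    (arrow i A).subst σ = arrow i (A.subst σ) := by
  induction i with
  | zero => rfl
  | succ i ih => simp only [arrow, subst, ih]

/-- The formula `(A →ᵢ₊₁ A) → (A → A)`. -/
def mark (i : ℕ) (A : Formula) : Formula := imp (arrow (i + 1) A) (imp A A)

theorem mark_inj {i j : ℕ} {A B : Formula} (h : mark i A = mark j B) : i = j ∧ A = B := by
  simp only [mark, imp.injEq] at h
  obtain ⟨h, rfl, -⟩ := h
  exact ⟨Nat.succ_injective (arrow_injective A h), rfl⟩

/-- The two halves of a mark are `arrow (i + 1) B` and `arrow 0 B`, which differ in size. This is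
why letter indices start at 1. -/
theorem imp_self_ne_mark (i : ℕ) (A B : Formula) : imp A A ≠ mark i B := by
  intro h
  simp only [mark, imp.injEq] at h
  have := arrow_injective B (a₁ := i + 1) (a₂ := 0) (h.1.symm.trans h.2)
  omega

theorem mark_ne_imp_mark (i j : ℕ) (A B C : Formula) : mark i A ≠ imp C (mark j B) := by
  intro h
  exact imp_self_ne_mark j A B (imp.inj h).2

theorem subst_mark (σ : ℕ → Formula) (i : ℕ) (A : Formula) :
    (mark i A).subst σ = mark i (A.subst σ) := by
  simp only [mark, subst, subst_arrow]

variable {m : ℕ}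

/-- The code of a word in which every letter has its own formula in the place of `p`. -/
def codeAt (w : List (Fin m × Formula)) (F : Formula) : Formula :=
  w.foldr (fun q G => imp G (mark q.1 q.2)) F

@[simp] theorem codeAt_nil (F : Formula) : codeAt ([] : List (Fin m × Formula)) F = F := rfl

@[simp] theorem codeAt_cons (q : Fin m × Formula) (w : List (Fin m × Formula)) (F : Formula) :
    codeAt (q :: w) F = imp (codeAt w F) (mark q.1 q.2) := rfl

theorem codeAt_append (v w : List (Fin m × Formula)) (F : Formula) :
    codeAt (v ++ w) F = codeAt v (codeAt w F) := by
  simp [codeAt]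

theorem subst_codeAt (σ : ℕ → Formula) (w : List (Fin m × Formula)) (F : Formula) :
    (codeAt w F).subst σ = codeAt (w.map fun q => (q.1, q.2.subst σ)) (F.subst σ) := by
  induction w with
  | nil => rfl
  | cons q w ih => simp [subst, ih, subst_mark]

/-- The outermost mark determines both the letter and its formula, so letters are peeled off in
parallel until one word is exhausted. -/
theorem codeAt_eq_codeAt {v w : List (Fin m × Formula)} {A B : Formula}
    (h : codeAt v A = codeAt w B) :
    (∃ u, w = v ++ u ∧ A = codeAt u B) ∨ (∃ u, v = w ++ u ∧ B = codeAt u A) := by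
  induction v generalizing w with
  | nil => exact .inl ⟨w, rfl, h⟩
  | cons q v ih =>
    cases w with
    | nil => exact .inr ⟨q :: v, rfl, h.symm⟩
    | cons r w =>
      simp only [codeAt_cons, imp.injEq] at h
      obtain ⟨h1, h2⟩ := h
      obtain ⟨h3, h4⟩ := mark_inj h2
      have hqr : q = r := Prod.ext (Fin.ext h3) h4
      subst hqr
      rcases ih h1 with ⟨u, rfl, h⟩ | ⟨u, rfl, h⟩
      · exact .inl ⟨u, rfl, h⟩
      · exact .inr ⟨u, rfl, h⟩

theorem codeAt_var_inj {v w : List (Fin m × Formula)} {n : ℕ}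
    (h : codeAt v (var n) = codeAt w (var n)) : v = w := by
  rcases codeAt_eq_codeAt h with ⟨u, rfl, h⟩ | ⟨u, rfl, h⟩ <;> cases u <;> simp_all

/-- The code of a word with the formula `A` in the place of `p`. -/
def wordCodeAt (A : Formula) (w : List (Fin m)) (F : Formula) : Formula :=
  codeAt (w.map fun a => (a, A)) F

theorem wordCode_eq (w : List (Fin m)) (F : Formula) : wordCode w F = wordCodeAt p w F := by
  induction w with
  | nil => rfl
  | cons a w ih => simp only [wordCode, ih]; rfl

theorem subst_wordCodeAt (σ : ℕ → Formula) (A : Formula) (w : List (Fin m)) (F : Formula) :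
    (wordCodeAt A w F).subst σ = wordCodeAt (A.subst σ) w (F.subst σ) := by
  simp [wordCodeAt, subst_codeAt, Function.comp_def]

theorem wordCodeAt_append (A : Formula) (v w : List (Fin m)) (F : Formula) :
    wordCodeAt A (v ++ w) F = wordCodeAt A v (wordCodeAt A w F) := by
  simp [wordCodeAt, codeAt_append]

theorem wordCodeAt_eq_imp_mark {w : List (Fin m)} (hw : w ≠ []) (A F : Formula) :
    ∃ (a : Fin m) (G : Formula), wordCodeAt A w F = imp G (mark a A) := by
  cases w with
  | nil => exact absurd rfl hw
  | cons a w => exact ⟨a, _, rfl⟩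

theorem wordCodeAt_ne_mark {w : List (Fin m)} (hw : w ≠ []) (A B F : Formula) (i : ℕ) :
    wordCodeAt A w F ≠ mark i B := by
  obtain ⟨a, G, h⟩ := wordCodeAt_eq_imp_mark hw A F
  exact h ▸ (mark_ne_imp_mark _ _ _ _ _).symm

/-! ### An invariant of derivations -/

/-- Codes of words that end in some formula `mark i A`. -/
def MarkEnded (m : ℕ) (F : Formula) : Prop :=
  ∃ (w : List (Fin m × Formula)) (i : ℕ) (A : Formula), F = codeAt w (mark i A)

theorem MarkEnded.of_codeAt {w : List (Fin m × Formula)} {F : Formula}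
    (h : MarkEnded m (codeAt w F)) : MarkEnded m F := by
  obtain ⟨v, i, A, h⟩ := h
  rcases codeAt_eq_codeAt h with ⟨u, -, h⟩ | ⟨u, -, h⟩
  · exact ⟨u, i, A, h⟩
  · cases u with
    | nil => exact ⟨[], i, A, h.symm⟩
    | cons q u => exact absurd h (mark_ne_imp_mark _ _ _ _ _)

theorem MarkEnded.subst {F : Formula} (h : MarkEnded m F) (σ : ℕ → Formula) :
    MarkEnded m (F.subst σ) := by
  obtain ⟨w, i, A, rfl⟩ := h
  exact ⟨_, i, A.subst σ, by rw [subst_codeAt, subst_mark]⟩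

/-- Some sequence of pairs of `S`, with formulas in the place of `p`, put around `A` and around `B`
gives equal formulas. -/
def FormulaJoins (S : Set (List (Fin m) × List (Fin m))) (A B : Formula) : Prop :=
  ∃ J : List ((List (Fin m) × List (Fin m)) × Formula), (∀ q ∈ J, q.1 ∈ S) ∧
    codeAt (J.flatMap fun q => q.1.1.map fun a => (a, q.2)) A =
      codeAt (J.flatMap fun q => q.1.2.map fun a => (a, q.2)) B

namespace FormulaJoins

variable {S : Set (List (Fin m) × List (Fin m))} {A B : Formula}

theorem refl (A : Formula) : FormulaJoins S A A := ⟨[], by simp, rfl⟩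

theorem of_wordCodeAt {q : List (Fin m) × List (Fin m)} (hq : q ∈ S) {C : Formula}
    (h : FormulaJoins S (wordCodeAt C q.1 A) (wordCodeAt C q.2 B)) : FormulaJoins S A B := by
  obtain ⟨J, hJ, h⟩ := h
  refine ⟨J ++ [(q, C)], ?_, ?_⟩
  · intro r hr
    rcases List.mem_append.1 hr with hr | hr
    · exact hJ r hr
    · rw [List.mem_singleton.1 hr]; exact hq
  · simpa [codeAt_append, wordCodeAt] using h

theorem subst (h : FormulaJoins S A B) (σ : ℕ → Formula) :
    FormulaJoins S (A.subst σ) (B.subst σ) := by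
  obtain ⟨J, hJ, h⟩ := h
  refine ⟨J.map fun q => (q.1, q.2.subst σ), ?_, ?_⟩
  · intro q hq
    obtain ⟨r, hr, rfl⟩ := List.mem_map.1 hq
    exact hJ r hr
  · have := congrArg (Formula.subst σ) h
    simpa [subst_codeAt, List.map_flatMap, List.flatMap_map, Function.comp_def] using this

theorem fst_flatMap (J : List ((List (Fin m) × List (Fin m)) × Formula)) :
    (J.flatMap fun q => q.1.1.map fun a => (a, q.2)).map Prod.fst =
      (J.map Prod.fst).flatMap Prod.fst ∧
    (J.flatMap fun q => q.1.2.map fun a => (a, q.2)).map Prod.fst =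
      (J.map Prod.fst).flatMap Prod.snd := by
  simp [List.map_flatMap, List.flatMap_map, Function.comp_def]

theorem mem_map_fst {J : List ((List (Fin m) × List (Fin m)) × Formula)}
    (hJ : ∀ q ∈ J, q.1 ∈ S) : ∀ q ∈ J.map Prod.fst, q ∈ S := by
  intro q hq
  obtain ⟨r, hr, rfl⟩ := List.mem_map.1 hq
  exact hJ r hr

/-- Of the two words put around `A` and `B`, one is a prefix of the other; `NoOverhang` excludes
that the one around `A` is properly shorter. -/
theorem eq_codeAt (hS : NoOverhang S) (h : FormulaJoins S A B) :
    ∃ w : List (Fin m × Formula), B = codeAt w A := by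
  obtain ⟨J, hJ, h⟩ := h
  rcases codeAt_eq_codeAt h with ⟨u, hu, h⟩ | ⟨u, -, h⟩
  · have h1 := congrArg (List.map Prod.fst) hu
    rw [List.map_append, (fst_flatMap J).1, (fst_flatMap J).2] at h1
    have h2 := hS _ (mem_map_fst hJ) _ h1.symm
    rw [List.map_eq_nil_iff.1 h2] at h
    exact ⟨[], h.symm⟩
  · exact ⟨u, h⟩

/-- Both codes end in the variable `x`, so the full words agree; forgetting the formulas in the
place of `p` leaves an equality of words. -/
theorem joins {u v : List (Fin m)} (h : FormulaJoins S (wordCode u x) (wordCode v x)) :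
    Joins S u v := by
  obtain ⟨J, hJ, h⟩ := h
  rw [wordCode_eq, wordCode_eq, wordCodeAt, wordCodeAt, ← codeAt_append, ← codeAt_append] at h
  have h1 := congrArg (List.map Prod.fst) (codeAt_var_inj h)
  rw [List.map_append, List.map_append, (fst_flatMap J).1, (fst_flatMap J).2] at h1
  exact ⟨_, mem_map_fst hJ, by simpa [Function.comp_def] using h1⟩

end FormulaJoins

/-- A set of formulas that contains the axioms of `P_Π` and is closed under modus ponens and under
arbitrary substitutions. -/
inductive Admissible (S : Set (List (Fin m) × List (Fin m))) : Formula → Prop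
  | letter (a : Fin m) (A F : Formula) : Admissible S (imp F (mark a A))
  | pair {q : List (Fin m) × List (Fin m)} (hq : q ∈ S) (C A B : Formula) :
      Admissible S (imp (imp (wordCodeAt C q.1 A) (wordCodeAt C q.2 B)) (imp A B))
  | joins {A B : Formula} (h : FormulaJoins S A B) : Admissible S (imp A B)
  | mark (i : ℕ) (A : Formula) : Admissible S (mark i A)
  | markEnded (A : Formula) {B : Formula} (h : MarkEnded m B) : Admissible S (imp A B)

namespace Admissible

variable {S : Set (List (Fin m) × List (Fin m))}

theorem subst {A : Formula} (h : Admissible S A) (σ : ℕ → Formula) :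
    Admissible S (A.subst σ) := by
  cases h with
  | letter a A F => simp only [Formula.subst, subst_mark]; exact letter _ _ _
  | pair hq C A B => simp only [Formula.subst, subst_wordCodeAt]; exact pair hq _ _ _
  | joins h => exact joins (h.subst σ)
  | mark i A => rw [subst_mark]; exact mark _ _
  | markEnded A h => exact markEnded _ (h.subst σ)

/-- This is modus ponens with an instance of a pair axiom. Nonempty words give the premise a shape
that neither a letter axiom nor a pair axiom has. -/
theorem of_wordCodeAt (hne : ∀ q ∈ S, q.1 ≠ [] ∧ q.2 ≠ [])
    {q : List (Fin m) × List (Fin m)} (hq : q ∈ S) {C A B : Formula}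
    (h : Admissible S (imp (wordCodeAt C q.1 A) (wordCodeAt C q.2 B))) :
    Admissible S (imp A B) := by
  generalize hD : imp (wordCodeAt C q.1 A) (wordCodeAt C q.2 B) = D at h
  cases h with
  | letter a A' F =>
    exact absurd (imp.inj hD).2 (wordCodeAt_ne_mark (hne q hq).2 _ _ _ _)
  | @pair r hr C' A' B' =>
    obtain ⟨h1, h2⟩ := imp.inj hD
    obtain ⟨a, G, h3⟩ := wordCodeAt_eq_imp_mark (hne q hq).1 C A
    rw [h3] at h1
    exact absurd (imp.inj h1).2.symm (wordCodeAt_ne_mark (hne r hr).2 _ _ _ _)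
  | joins h =>
    obtain ⟨rfl, rfl⟩ := imp.inj hD
    exact joins (h.of_wordCodeAt hq)
  | mark i A' =>
    obtain ⟨-, h2⟩ := imp.inj hD
    obtain ⟨a, G, h3⟩ := wordCodeAt_eq_imp_mark (hne q hq).2 C B
    have h4 := (imp.inj (h3.symm.trans h2)).2
    -- Here `A'` is `mark a C`, so the second code is `mark a C → mark a C`, itself a one-letter
    -- code around a mark. This coincidence is what forces `MarkEnded` into the invariant.
    refine markEnded _ (MarkEnded.of_codeAt (w := q.2.map fun a => (a, C)) ?_)
    refine ⟨[(a, C)], a, C, ?_⟩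
    simp only [codeAt_cons, codeAt_nil]
    rw [h4]
    exact h2
  | markEnded A' h =>
    obtain ⟨-, rfl⟩ := imp.inj hD
    exact markEnded _ h.of_codeAt

theorem mp (hne : ∀ q ∈ S, q.1 ≠ [] ∧ q.2 ≠ []) (hS : NoOverhang S) {A B : Formula}
    (hA : Admissible S A) (hAB : Admissible S (imp A B)) : Admissible S B := by
  generalize hD : imp A B = D at hAB
  cases hAB with
  | letter a A' F =>
    obtain ⟨-, rfl⟩ := imp.inj hD
    exact mark _ _
  | pair hq C A' B' =>
    obtain ⟨rfl, rfl⟩ := imp.inj hD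
    exact hA.of_wordCodeAt hne hq
  | joins h =>
    obtain ⟨rfl, rfl⟩ := imp.inj hD
    obtain ⟨w, rfl⟩ := h.eq_codeAt hS
    cases w with
    | nil => exact hA
    | cons q w => exact letter _ _ _
  | mark i A' =>
    obtain ⟨-, rfl⟩ := imp.inj hD
    exact joins (.refl _)
  | markEnded A' h =>
    obtain ⟨-, rfl⟩ := imp.inj hD
    obtain ⟨w, i, C, rfl⟩ := h
    cases w with
    | nil => exact mark _ _
    | cons q w => exact letter _ _ _

/-- A code ending in a variable is not mark-ended, and the outer shape excludes every other case
except `joins`. -/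
theorem joins_of_wordCode (hne : ∀ q ∈ S, q.1 ≠ [] ∧ q.2 ≠ []) {u v : List (Fin m)}
    (hu : u ≠ []) (hv : v ≠ []) (h : Admissible S (imp (wordCode u x) (wordCode v x))) :
    Joins S u v := by
  have hx : ¬ MarkEnded m (wordCode v x) := by
    intro h
    rw [wordCode_eq] at h
    obtain ⟨w, i, C, h⟩ := h.of_codeAt
    cases w <;> simp [x, IterCalc.mark] at h
  generalize hD : imp (wordCode u x) (wordCode v x) = D at h
  cases h with
  | letter a A' F =>
    rw [wordCode_eq v] at hD
    exact absurd (imp.inj hD).2 (wordCodeAt_ne_mark hv _ _ _ _)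
  | @pair r hr C' A' B' =>
    obtain ⟨h1, h2⟩ := imp.inj hD
    obtain ⟨a, G, h3⟩ := wordCodeAt_eq_imp_mark hu p x
    rw [wordCode_eq, h3] at h1
    exact absurd (imp.inj h1).2.symm (wordCodeAt_ne_mark (hne r hr).2 _ _ _ _)
  | joins h =>
    obtain ⟨rfl, rfl⟩ := imp.inj hD
    exact h.joins
  | mark i A' =>
    obtain ⟨-, h2⟩ := imp.inj hD
    obtain ⟨a, G, h3⟩ := wordCodeAt_eq_imp_mark hv p x
    have h4 := (imp.inj (h3.symm.trans ((wordCode_eq v x).symm.trans h2))).2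
    refine absurd ⟨[(a, p)], a, p, ?_⟩ hx
    simp only [codeAt_cons, codeAt_nil]
    rw [h4]
    exact h2
  | markEnded A' h =>
    obtain ⟨-, rfl⟩ := imp.inj hD
    exact absurd h hx

end Admissible

/-! ### Derivable implications between codes -/

namespace PostInstance

variable (I : PostInstance m)

/-- The set of pairs of a Post correspondence instance. -/
def system : Set (List (Fin m) × List (Fin m)) := {q | q ∈ I.pairs}

theorem mem_calculus {A : Formula} : A ∈ I.calculus ↔
    (∃ a : Fin m, letterCode a x = A) ∨
    (∃ q ∈ I.pairs, imp (imp (wordCode q.1 x) (wordCode q.2 y)) (imp x y) = A) ∨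
    (∃ a : Fin m, imp (letterCode a x) (letterCode a x) = A) := by
  simp [calculus]

variable {I}

theorem admissible_of_mem {A : Formula} (hA : A ∈ I.calculus) : Admissible I.system A := by
  rcases I.mem_calculus.1 hA with ⟨a, rfl⟩ | ⟨q, hq, rfl⟩ | ⟨a, rfl⟩
  · exact .letter a p x
  · rw [wordCode_eq, wordCode_eq]
    exact .pair hq p x y
  · exact .joins (.refl _)

theorem admissible_of_derivable (hI : NoOverhang I.system) {A : Formula}
    (h : Derivable I.calculus A) : Admissible I.system A := by
  induction h with
  | ax hA => exact admissible_of_mem hA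
  | mp _ _ ihA ihAB => exact ihA.mp I.nonempty hI ihAB
  | superpose v _ _ ihA _ => exact ihA.subst _
  | rename ρ _ ihA => exact ihA.subst _

/-- Weak substitution inserts only derivable formulas; this makes codes of nonempty words available
for it. -/
theorem weaklyDerivable_wordCode {w : List (Fin m)} (hw : w ≠ []) :
    WeaklyDerivable I.calculus (wordCode w x) := by
  induction w with
  | nil => exact absurd rfl hw
  | cons a w ih =>
    have ha : WeaklyDerivable I.calculus (letterCode a x) :=
      .ax (I.mem_calculus.2 (.inl ⟨a, rfl⟩))
    cases w with
    | nil => exact ha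
    | cons b w =>
      have := ha.superpose 0 (ih (by simp))
      have e : (letterCode a x).replace 0 (wordCode (b :: w) x) = wordCode (a :: b :: w) x := by
        simp [Formula.replace, letterCode, wordCode, Formula.subst, subst_arrow, x, p]
      rwa [e] at this

theorem weaklyDerivable_refl {w : List (Fin m)} (hw : w ≠ []) :
    WeaklyDerivable I.calculus (imp (wordCode w x) (wordCode w x)) := by
  cases w with
  | nil => exact absurd rfl hw
  | cons a w =>
    have ha : WeaklyDerivable I.calculus (imp (letterCode a x) (letterCode a x)) :=
      .ax (I.mem_calculus.2 (.inr (.inr ⟨a, rfl⟩)))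
    cases w with
    | nil => exact ha
    | cons b w =>
      have := ha.superpose 0 (weaklyDerivable_wordCode (w := b :: w) (by simp))
      have e : (imp (letterCode a x) (letterCode a x)).replace 0 (wordCode (b :: w) x) =
          imp (wordCode (a :: b :: w) x) (wordCode (a :: b :: w) x) := by
        simp [Formula.replace, letterCode, wordCode, Formula.subst, subst_arrow, x, p]
      rwa [e] at this

theorem weaklyDerivable_of_append {q : List (Fin m) × List (Fin m)} (hq : q ∈ I.pairs)
    {u v : List (Fin m)} (hu : u ≠ []) (hv : v ≠ [])
    (h : WeaklyDerivable I.calculus (imp (wordCode (q.1 ++ u) x) (wordCode (q.2 ++ v) x))) :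
    WeaklyDerivable I.calculus (imp (wordCode u x) (wordCode v x)) := by
  have hax : WeaklyDerivable I.calculus
      (imp (imp (wordCode q.1 x) (wordCode q.2 y)) (imp x y)) :=
    .ax (I.mem_calculus.2 (.inr (.inl ⟨q, hq, rfl⟩)))
  -- The order matters: `wordCode u x` does not contain `y`, so the second replacement leaves it
  -- alone, whereas `wordCode v x` contains `x`.
  have := (hax.superpose 0 (weaklyDerivable_wordCode hu)).superpose 1
    (weaklyDerivable_wordCode hv)
  refine .mp h ?_
  have hid : ∀ w : List (Fin m), (wordCode w x).subst (Function.update var 1 (wordCode v x)) =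
      wordCode w x := by
    intro w
    rw [wordCode_eq w, subst_wordCodeAt]
    simp [p, x, Formula.subst]
  convert this using 1
  simp only [Formula.replace, Formula.subst, wordCode_eq q.1, wordCode_eq q.2, subst_wordCodeAt]
  simp only [x, y, p, Formula.subst, Function.update_self, ne_eq, OfNat.ofNat_ne_zero,
    not_false_eq_true, Function.update_of_ne, one_ne_zero, OfNat.ofNat_ne_one]
  have hid' := hid u
  simp only [x] at hid'
  rw [hid', wordCode_eq (q.1 ++ u), wordCode_eq (q.2 ++ v), wordCodeAt_append, wordCodeAt_append,
    wordCode_eq u, wordCode_eq v]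
  rfl

theorem weaklyDerivable_of_joins {u v : List (Fin m)} (hu : u ≠ []) (hv : v ≠ [])
    (h : Joins I.system u v) :
    WeaklyDerivable I.calculus (imp (wordCode u x) (wordCode v x)) := by
  obtain ⟨J, hJ, h⟩ := h
  induction J using List.reverseRecOn generalizing u v with
  | nil =>
    have : u = v := h
    exact this ▸ weaklyDerivable_refl hu
  | append_singleton J q ih =>
    -- The last pair of the sequence is adjacent to `u` and `v`, hence innermost, and is stripped
    -- last.
    refine weaklyDerivable_of_append (hJ q (by simp)) hu hv (ih (by simp [hu]) (by simp [hv])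
      (fun r hr => hJ r (by simp [hr])) ?_)
    simpa using h

theorem derivable_of_weaklyDerivable {A : Formula} (h : WeaklyDerivable I.calculus A) :
    Derivable I.calculus A := by
  induction h with
  | ax hA => exact .ax hA
  | mp _ _ ihA ihAB => exact .mp ihA ihAB
  | superpose v _ _ ihA ihB => exact .superpose v ihA ihB

theorem derivable_iff_joins (hI : NoOverhang I.system) {u v : List (Fin m)} (hu : u ≠ [])
    (hv : v ≠ []) :
    Derivable I.calculus (imp (wordCode u x) (wordCode v x)) ↔ Joins I.system u v :=
  ⟨fun h => (admissible_of_derivable hI h).joins_of_wordCode I.nonempty hu hv,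
    fun h => derivable_of_weaklyDerivable (weaklyDerivable_of_joins hu hv h)⟩

theorem weaklyDerivable_iff_joins (hI : NoOverhang I.system) {u v : List (Fin m)} (hu : u ≠ [])
    (hv : v ≠ []) :
    WeaklyDerivable I.calculus (imp (wordCode u x) (wordCode v x)) ↔ Joins I.system u v :=
  ⟨fun h => (derivable_iff_joins hI hu hv).1 (derivable_of_weaklyDerivable h),
    weaklyDerivable_of_joins hu hv⟩

end PostInstance

/-! ### Joining words -/

section Joins

variable {α : Type*} {S : Set (List α × List α)}

theorem Joins.refl (u : List α) : Joins S u u := ⟨[], by simp, rfl⟩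

theorem Joins.of_append {q : List α × List α} (hq : q ∈ S) {u v : List α}
    (h : Joins S (q.1 ++ u) (q.2 ++ v)) : Joins S u v := by
  obtain ⟨J, hJ, h⟩ := h
  refine ⟨J ++ [q], ?_, by simpa using h⟩
  intro r hr
  rcases List.mem_append.1 hr with hr | hr
  · exact hJ r hr
  · rw [List.mem_singleton.1 hr]; exact hq

end Joins

/-! ### Coding of letters by words over a smaller alphabet -/

section Coding

variable {α β : Type*} {f : α → List β}

/-- The image of a pair of words under the coding `f` of letters. -/
def codePair (f : α → List β) (q : List α × List α) : List β × List β :=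
  (q.1.flatMap f, q.2.flatMap f)

/-- A coding of letters whose words can be read off from left to right. -/
def IsPrefixCode (f : α → List β) : Prop :=
  ∀ (a b : α) (u v : List β), f a ++ u = f b ++ v → a = b

theorem IsPrefixCode.isPrefix (hf : IsPrefixCode f) (hne : ∀ a, f a ≠ []) {v w : List α}
    {u : List β} (h : v.flatMap f ++ u = w.flatMap f) : ∃ z, w = v ++ z ∧ u = z.flatMap f := by
  induction v generalizing w with
  | nil => exact ⟨w, rfl, h⟩
  | cons a v ih =>
    cases w with
    | nil => simp [hne] at h
    | cons b w =>
      simp only [List.flatMap_cons, List.append_assoc] at h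
      obtain rfl := hf a b _ _ h
      obtain ⟨z, rfl, hz⟩ := ih (List.append_cancel_left h)
      exact ⟨z, rfl, hz⟩

theorem IsPrefixCode.flatMap_injective (hf : IsPrefixCode f) (hne : ∀ a, f a ≠ []) :
    Function.Injective fun w : List α => w.flatMap f := by
  intro v w h
  obtain ⟨z, rfl, hz⟩ := hf.isPrefix hne (v := v) (w := w) (u := [])
    ((List.append_nil _).trans h)
  cases z with
  | nil => simp
  | cons a z => simp [hne] at hz

theorem exists_map_codePair {S : Set (List α × List α)} {J : List (List β × List β)}
    (hJ : ∀ q ∈ J, q ∈ codePair f '' S) :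
    ∃ K : List (List α × List α), (∀ q ∈ K, q ∈ S) ∧
      J.flatMap Prod.fst = (K.flatMap Prod.fst).flatMap f ∧
      J.flatMap Prod.snd = (K.flatMap Prod.snd).flatMap f := by
  induction J with
  | nil => exact ⟨[], by simp⟩
  | cons q J ih =>
    obtain ⟨K, hK, h1, h2⟩ := ih fun r hr => hJ r (by simp [hr])
    obtain ⟨r, hr, rfl⟩ := hJ q (by simp)
    exact ⟨r :: K, by simpa using ⟨hr, by simpa using hK⟩, by simp [h1, codePair],
      by simp [h2, codePair]⟩

variable {S : Set (List α × List α)}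

theorem NoOverhang.image (hf : IsPrefixCode f) (hne : ∀ a, f a ≠ []) (hS : NoOverhang S) :
    NoOverhang (codePair f '' S) := by
  intro J hJ u h
  obtain ⟨K, hK, h1, h2⟩ := exists_map_codePair hJ
  rw [h1, h2] at h
  obtain ⟨z, hz, rfl⟩ := hf.isPrefix hne h
  rw [hS K hK z hz.symm, List.flatMap_nil]

theorem joins_image_iff (hf : IsPrefixCode f) (hne : ∀ a, f a ≠ []) {u v : List α} :
    Joins (codePair f '' S) (u.flatMap f) (v.flatMap f) ↔ Joins S u v := by
  constructor
  · rintro ⟨J, hJ, h⟩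
    obtain ⟨K, hK, h1, h2⟩ := exists_map_codePair hJ
    rw [h1, h2, ← List.flatMap_append, ← List.flatMap_append] at h
    exact ⟨K, hK, hf.flatMap_injective hne h⟩
  · rintro ⟨J, hJ, h⟩
    refine ⟨J.map (codePair f), ?_, ?_⟩
    · intro q hq
      obtain ⟨r, hr, rfl⟩ := List.mem_map.1 hq
      exact ⟨r, hJ r hr, rfl⟩
    · have := congrArg (List.flatMap f) h
      simpa [List.flatMap_map, List.flatMap_assoc, codePair] using this

/-- The letter number `k` is coded by `z ⋯ z o`, with `k` letters `z`. -/
theorem isPrefixCode_replicate {z o : β} (hzo : z ≠ o) {e : α → ℕ} (he : Function.Injective e) :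
    IsPrefixCode fun a => List.replicate (e a) z ++ [o] := by
  intro a b u v h
  refine he ?_
  simp only [List.append_assoc, List.singleton_append] at h
  generalize e a = i at h
  generalize e b = j at h
  induction i generalizing j with
  | zero =>
    cases j with
    | zero => rfl
    | succ j => simp [List.replicate_succ, hzo.symm] at h
  | succ i ih =>
    cases j with
    | zero => simp [List.replicate_succ, hzo] at h
    | succ j =>
      simp only [List.replicate_succ, List.cons_append, List.cons.injEq, true_and] at h
      rw [ih j h]

end Coding

/-! ### From semi-Thue systems to Post correspondence systems -/

section SemiThue

variable {α : Type*}

/-- One step of the semi-Thue system with the rules `R`. -/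
def Rewrites (R : Set (List α × List α)) (u v : List α) : Prop :=
  ∃ q ∈ R, ∃ a b : List α, u = a ++ q.1 ++ b ∧ v = a ++ q.2 ++ b

/-- The letters of a semi-Thue system with three additional signs. -/
inductive Signed (α : Type*) : Type _
  | letter (a : α) : Signed α
  | star : Signed α
  | bar : Signed α
  | dollar : Signed α

namespace Signed

instance [Finite α] : Finite (Signed α) :=
  Finite.of_injective (β := Option (Option (Option α)))
    (fun | letter a => some (some (some a)) | star => none | bar => some none
         | dollar => some (some none))
    (by rintro (a | _ | _ | _) (b | _ | _ | _) h <;> simp_all)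

/-- A star is put before each letter. -/
def pre (w : List (Signed α)) : List (Signed α) := w.flatMap fun a => [star, a]

/-- A star is put after each letter. -/
def post (w : List (Signed α)) : List (Signed α) := w.flatMap fun a => [a, star]

/-- A single star passes through a word and turns one placement of stars into the other; this keeps
the two sides in phase. -/
theorem pre_append_star (w : List (Signed α)) : pre w ++ [star] = star :: post w := by
  induction w with
  | nil => rfl
  | cons a w ih => simp [pre, post] at ih ⊢; simp [ih]

theorem post_append (v w : List (Signed α)) : post (v ++ w) = post v ++ post w := by
  simp [post]

/-- The stars are removed. -/
def unstar : List (Signed α) → List (Signed α)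
  | [] => []
  | star :: w => unstar w
  | letter a :: w => letter a :: unstar w
  | bar :: w => bar :: unstar w
  | dollar :: w => dollar :: unstar w

theorem unstar_append (v w : List (Signed α)) : unstar (v ++ w) = unstar v ++ unstar w := by
  induction v with
  | nil => rfl
  | cons a v ih => cases a <;> simp [unstar, ih]

theorem unstar_pre_letter (w : List α) : unstar (pre (w.map letter)) = w.map letter := by
  induction w with
  | nil => rfl
  | cons a w ih => simp only [pre] at ih; simp [pre, unstar, ih]

theorem unstar_post_letter (w : List α) : unstar (post (w.map letter)) = w.map letter := by
  induction w with
  | nil => rfl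
  | cons a w ih => simp only [post] at ih; simp [post, unstar, ih]

end Signed

open Signed

/-- The Post correspondence system of the semi-Thue system `R` with the final letter `t`. -/
inductive StarPair (R : Set (List α × List α)) (t : α) :
    List (Signed α) × List (Signed α) → Prop
  | copy (a : α) : StarPair R t (pre [letter a], post [letter a])
  | bar : StarPair R t (pre [bar], post [bar])
  | rule {q : List α × List α} (hq : q ∈ R) :
      StarPair R t (pre (q.1.map letter), post (q.2.map letter))
  | final : StarPair R t ([dollar, Signed.bar, star, letter t], [dollar])

/-- The pairs of `StarPair` without their stars. -/
inductive PlainPair (R : Set (List α × List α)) (t : α) :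
    List (Signed α) × List (Signed α) → Prop
  | copy (a : α) : PlainPair R t ([letter a], [letter a])
  | bar : PlainPair R t ([bar], [bar])
  | rule {q : List α × List α} (hq : q ∈ R) :
      PlainPair R t (q.1.map letter, q.2.map letter)
  | final : PlainPair R t ([dollar, Signed.bar, letter t], [dollar])

variable {R : Set (List α × List α)} {t : α}

theorem StarPair.unstar {q : List (Signed α) × List (Signed α)} (h : StarPair R t q) :
    PlainPair R t (unstar q.1, unstar q.2) := by
  cases h with
  | copy a => exact .copy a
  | bar => exact .bar
  | rule hq => simp only [unstar_pre_letter, unstar_post_letter]; exact .rule hq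
  | final => exact .final

theorem StarPair.ne_nil (hR : ∀ q ∈ R, q.1 ≠ [] ∧ q.2 ≠ [])
    {q : List (Signed α) × List (Signed α)} (h : StarPair R t q) : q.1 ≠ [] ∧ q.2 ≠ [] := by
  cases h with
  | copy a => simp [pre, post]
  | bar => simp [pre, post]
  | @rule q hq =>
    obtain ⟨h1, h2⟩ := hR q hq
    obtain ⟨a, l, e1⟩ := List.exists_cons_of_ne_nil h1
    obtain ⟨b, r, e2⟩ := List.exists_cons_of_ne_nil h2
    simp [pre, post, e1, e2]
  | final => simp

theorem finite_starPair [Finite α] (hR : R.Finite) : {q | StarPair R t q}.Finite := by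
  refine Set.Finite.subset (((Set.finite_range fun a : α => (pre [letter a], post [letter a])).union
    (hR.image fun q => (pre (q.1.map letter), post (q.2.map letter)))).union
    (Set.toFinite {(pre [bar], post [bar]),
      ([dollar, bar, star, letter t], [dollar])})) ?_
  rintro q (a | _ | hq | _)
  · exact .inl (.inl ⟨a, rfl⟩)
  · exact .inr (.inl rfl)
  · exact .inl (.inr ⟨_, hq, rfl⟩)
  · exact .inr (.inr rfl)

theorem StarPair.exists_of_ne_final (hR : ∀ q ∈ R, q.1 ≠ [] ∧ q.2 ≠ [])
    {q : List (Signed α) × List (Signed α)} (h : StarPair R t q)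
    (hq : q ≠ ([dollar, Signed.bar, star, letter t], [dollar])) :
    ∃ a u v, q.1 = star :: u ∧ q.2 = a :: v ∧ a ≠ star := by
  cases h with
  | copy a => exact ⟨_, _, _, rfl, rfl, by simp⟩
  | bar => exact ⟨_, _, _, rfl, rfl, by simp⟩
  | @rule q h =>
    obtain ⟨h1, h2⟩ := hR q h
    obtain ⟨a, l, e1⟩ := List.exists_cons_of_ne_nil h1
    obtain ⟨b, r, e2⟩ := List.exists_cons_of_ne_nil h2
    exact ⟨letter b, letter a :: pre (l.map letter), star :: post (r.map letter),
      by simp [pre, e1], by simp [post, e2], by simp⟩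
  | final => exact absurd rfl hq

-- Bars measure the deficit: no pair has more of them in its second component, and the final pair
-- has strictly fewer.
open Classical in
theorem StarPair.count_le {q : List (Signed α) × List (Signed α)} (h : StarPair R t q) :
    q.2.count Signed.bar ≤ q.1.count Signed.bar := by
  have aux : ∀ w : List α, (post (w.map letter)).count Signed.bar = 0 := by
    intro w
    refine List.count_eq_zero.2 ?_
    simp [post]
  cases h with
  | copy a => simp [pre, post]
  | bar => simp [pre, post]
  | rule hq => simp [aux]
  | final => simp

open Classical in
theorem StarPair.count_flatMap_le {J : List (List (Signed α) × List (Signed α))}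
    (hJ : ∀ q ∈ J, StarPair R t q) :
    (J.flatMap Prod.snd).count Signed.bar ≤ (J.flatMap Prod.fst).count Signed.bar := by
  induction J with
  | nil => simp
  | cons q J ih =>
    simp only [List.flatMap_cons, List.count_append]
    exact add_le_add (hJ q (by simp)).count_le (ih fun r hr => hJ r (by simp [hr]))

/-- If the first pair is not final, its components start with a star and a non-star, so the sides
differ at once. If it is final, the first side has more bars than the second. -/
theorem noOverhang_starPair (hR : ∀ q ∈ R, q.1 ≠ [] ∧ q.2 ≠ []) :
    NoOverhang {q | StarPair R t q} := by
  classical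
  intro J hJ u h
  cases J with
  | nil => simpa using h
  | cons q J =>
    have hq : StarPair R t q := hJ q (by simp)
    by_cases hf : q = ([dollar, Signed.bar, star, letter t], [dollar])
    · have h1 := StarPair.count_flatMap_le (J := J) fun r hr => hJ r (by simp [hr])
      have h2 := congrArg (List.count Signed.bar) h
      simp [hf] at h2
      omega
    · obtain ⟨a, v, w, h1, h2, ha⟩ := hq.exists_of_ne_final hR hf
      simp only [List.flatMap_cons, h1, h2, List.cons_append, List.cons.injEq] at h
      exact absurd h.1.symm ha

/-! ### Joining sequences and rewriting sequences -/

theorem flatMap_unstar (J : List (List (Signed α) × List (Signed α))) :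
    unstar (J.flatMap Prod.fst) = (J.map fun q => (unstar q.1, unstar q.2)).flatMap Prod.fst ∧
    unstar (J.flatMap Prod.snd) = (J.map fun q => (unstar q.1, unstar q.2)).flatMap Prod.snd := by
  induction J with
  | nil => exact ⟨rfl, rfl⟩
  | cons q J ih => simp [unstar_append, ih]

theorem bar_notMem_map (w : List α) : bar ∉ w.map letter := by simp

/-- The overhang `v | u` stands for the word `u v`. Read from the right end, a copy pair moves the
last letter of `u` to the front of `v`, a rule replaces a suffix of `u` by its right-hand side at
the front of `v`, the bar pair starts a new pass once `u` is empty, and the final pair fits only the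
overhang `| t`. -/
theorem reaches_of_plainPair {w : List α} {J : List (List (Signed α) × List (Signed α))}
    (hJ : ∀ q ∈ J, PlainPair R t q) {u v : List α}
    (huv : Relation.ReflTransGen (Rewrites R) w (u ++ v))
    (h : J.flatMap Prod.fst = J.flatMap Prod.snd ++ (v.map letter ++ bar :: u.map letter)) :
    Relation.ReflTransGen (Rewrites R) w [t] := by
  induction J using List.reverseRecOn generalizing u v with
  | nil => simp at h
  | append_singleton J q ih =>
    have ih' := @ih fun r hr => hJ r (by simp [hr])
    clear ih
    simp only [List.flatMap_append, List.flatMap_singleton, List.append_assoc] at h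
    have hq := hJ q (by simp)
    rcases List.append_eq_append_iff.1 h with ⟨c, -, h2⟩ | ⟨c, h1, h2⟩
    · cases hq with
      | copy a => have := congrArg List.length h2; simp at this; omega
      | bar => have := congrArg List.length h2; simp at this; omega
      | @rule q hq =>
        have : bar ∈ q.1.map letter := by
          have h3 : q.1.map letter = _ := h2
          rw [h3]; simp
        exact absurd this (bar_notMem_map _)
      | final =>
        rcases c with _ | ⟨_, _ | ⟨_, _ | ⟨_, _⟩⟩⟩ <;> simp at h2
        rcases v with _ | ⟨_, v⟩ <;> simp at h2
        rcases u with _ | ⟨_, _ | _⟩ <;> simp at h2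
        subst h2
        exact huv
    · cases hq with
      | copy a =>
        rcases u.eq_nil_or_concat with rfl | ⟨u, b, rfl⟩
        · have h3 : (letter a :: v.map letter) ++ [bar] = c ++ [letter a] := by simpa using h2
          simpa using (List.append_inj' h3 rfl).2
        · have h3 : (letter a :: v.map letter ++ bar :: u.map letter) ++ [letter b] =
            c ++ [letter a] := by simpa using h2
          obtain ⟨h4, h5⟩ := List.append_inj' h3 rfl
          simp only [List.cons.injEq, letter.injEq, and_true] at h5
          subst h5
          refine ih' (u := u) (v := b :: v) (by simpa using huv) ?_
          rw [h1, ← h4]; simp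
      | bar =>
        rcases u.eq_nil_or_concat with rfl | ⟨u, b, rfl⟩
        · have h3 : (bar :: v.map letter) ++ [bar] = c ++ [bar] := by simpa using h2
          obtain ⟨h4, -⟩ := List.append_inj' h3 rfl
          refine ih' (u := v) (v := []) (by simpa using huv) ?_
          rw [h1, ← h4]; simp
        · have h3 : (bar :: v.map letter ++ bar :: u.map letter) ++ [letter b] =
            c ++ [bar] := by simpa using h2
          simpa using (List.append_inj' h3 rfl).2
      | @rule q hq =>
        have h3 : (q.2.map letter ++ v.map letter ++ [bar]) ++ u.map letter =
          c ++ q.1.map letter := by simpa using h2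
        rcases List.append_eq_append_iff.1 h3 with ⟨d, h4, h5⟩ | ⟨d, h4, h5⟩
        · obtain ⟨u1, u2, rfl, rfl, h6⟩ := List.map_eq_append_iff.1 h5
          have h7 : u2 = q.1 := List.map_injective_iff.2 (fun _ _ h => letter.inj h) h6
          subst h7
          refine ih' (u := u1) (v := q.2 ++ v) (huv.tail ⟨q, hq, u1, v, by simp, by simp⟩) ?_
          rw [h1, h4]; simp
        -- A left-hand side longer than `u` would have to contain the bar.
        · rcases d.eq_nil_or_concat with rfl | ⟨d, b, rfl⟩
          · have h7 : q.1 = u := List.map_injective_iff.2 (fun _ _ h => letter.inj h) h5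
            subst h7
            refine ih' (u := []) (v := q.2 ++ v) (huv.tail ⟨q, hq, [], v, by simp, by simp⟩) ?_
            rw [h1]
            simp only [List.append_nil] at h4
            rw [← h4]; simp
          · have h6 : (q.2.map letter ++ v.map letter) ++ [bar] = (c ++ d) ++ [b] := by
              simpa using h4
            obtain ⟨-, h7⟩ := List.append_inj' h6 rfl
            obtain rfl : bar = b := by simpa using h7
            have : bar ∈ q.1.map letter := by rw [h5]; simp
            exact absurd this (bar_notMem_map _)
      | final =>
        have h3 : (dollar :: v.map letter ++ [bar]) ++ u.map letter =
          (c ++ [dollar, bar]) ++ [letter t] := by simpa using h2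
        rcases u.eq_nil_or_concat with rfl | ⟨u, b, rfl⟩
        · rw [List.map_nil, List.append_nil] at h3
          simpa using (List.append_inj' h3 rfl).2
        · have h4 : ((dollar :: v.map letter ++ [bar]) ++ u.map letter) ++ [letter b] =
            (c ++ [dollar, bar]) ++ [letter t] := by simpa using h3
          obtain ⟨h5, h6⟩ := List.append_inj' h4 rfl
          simp only [List.cons.injEq, letter.injEq, and_true] at h6
          subst h6
          rcases u.eq_nil_or_concat with rfl | ⟨u, d, rfl⟩
          · rcases v.eq_nil_or_concat with rfl | ⟨v, d, rfl⟩
            · simpa using huv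
            · have h7 : (dollar :: v.map letter) ++ [letter d, bar] = c ++ [dollar, bar] := by
                simpa using h5
              simpa using (List.append_inj' h7 rfl).2
          · have h7 : (dollar :: v.map letter ++ [bar] ++ u.map letter) ++ [letter d] =
              (c ++ [dollar]) ++ [bar] := by simpa using h5
            simpa using (List.append_inj' h7 rfl).2

theorem reaches_of_joins {w : List α}
    (h : Joins {q | StarPair R t q} [star] (post (bar :: w.map letter))) :
    Relation.ReflTransGen (Rewrites R) w [t] := by
  obtain ⟨J, hJ, h⟩ := h
  have h1 := congrArg Signed.unstar h
  rw [unstar_append, unstar_append, (flatMap_unstar J).1, (flatMap_unstar J).2] at h1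
  have h2 : unstar (post (bar :: w.map letter)) = bar :: w.map letter := by
    have := unstar_post_letter w
    simp only [post] at this
    simp [post, Signed.unstar, this]
  rw [h2] at h1
  refine reaches_of_plainPair (u := w) (v := []) ?_ (by simpa using .refl)
    (by simpa [Signed.unstar] using h1)
  intro q hq
  obtain ⟨r, hr, rfl⟩ := List.mem_map.1 hq
  exact StarPair.unstar (hJ r hr)

/-- The overhang `s` can be removed by the pairs of `StarPair R t`. -/
def Removable (R : Set (List α × List α)) (t : α) (s : List (Signed α)) : Prop :=
  ∀ u, Joins {q | StarPair R t q} (star :: u) (post s ++ u)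

/-- The overhang acts as a queue: `l` leaves at the right end, `r` enters on the left, and `post l`
joins the common suffix. This is why `Removable` quantifies over all suffixes. -/
theorem Removable.of_pair {l r s : List (Signed α)} (hq : StarPair R t (pre l, post r))
    (h : Removable R t (r ++ s)) : Removable R t (s ++ l) := by
  intro u
  refine Joins.of_append (S := {q | StarPair R t q}) hq ?_
  have := h (post l ++ u)
  have e : pre l ++ star :: u = star :: (post l ++ u) := by
    rw [← List.cons_append, ← pre_append_star]; simp
  simpa [e, post_append] using this

theorem Removable.of_copy {w : List α} {s : List (Signed α)}
    (h : Removable R t (w.map letter ++ s)) : Removable R t (s ++ w.map letter) := by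
  induction w using List.reverseRecOn generalizing s with
  | nil => simpa using h
  | append_singleton w a ih =>
    have := (ih (s := letter a :: s) (by simpa using h))
    have := Removable.of_pair (l := [letter a]) (r := [letter a]) (s := s ++ w.map letter)
      (.copy a) (by simpa using this)
    simpa using this

theorem removable_of_reaches {w : List α} (h : Relation.ReflTransGen (Rewrites R) w [t]) :
    Removable R t (bar :: w.map letter) := by
  induction h using Relation.ReflTransGen.head_induction_on with
  | refl =>
    intro u
    exact Joins.of_append (S := {q | StarPair R t q}) .final (by simpa [post] using .refl _)
  | head h _ ih =>
    obtain ⟨q, hq, a, b, rfl, rfl⟩ := h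
    -- The rotation is built backwards. Forwards, the overhangs are `| a l b`, `b | a l`, `r b | a`,
    -- `a r b |`, `| a r b`, where `q` is `(l, r)`.
    have h1 : Removable R t ((a ++ q.2 ++ b).map letter ++ [bar]) :=
      Removable.of_pair (l := [bar]) (r := [bar]) .bar (by simpa using ih)
    have h2 := Removable.of_copy (w := a) (s := (q.2 ++ b).map letter ++ [bar])
      (by simpa using h1)
    have h3 := Removable.of_pair (s := b.map letter ++ bar :: a.map letter) (.rule hq)
      (by simpa using h2)
    have h4 := Removable.of_copy (w := b) (s := bar :: (a ++ q.1).map letter)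
      (by simpa using h3)
    simpa using h4

theorem joins_starPair_iff {w : List α} :
    Joins {q | StarPair R t q} [star] (post (bar :: w.map letter)) ↔
      Relation.ReflTransGen (Rewrites R) w [t] :=
  ⟨reaches_of_joins, fun h => by simpa using removable_of_reaches h []⟩

end SemiThue

/-! ### Turing machines as semi-Thue systems -/

section TuringMachine

open Turing

/-- The letters of the words that describe the configurations of a Turing machine. -/
inductive TapeLetter (Γ Q : Type*) : Type _
  | leftEnd : TapeLetter Γ Q
  | rightEnd : TapeLetter Γ Q
  | halted : TapeLetter Γ Q
  | symbol (a : Γ) : TapeLetter Γ Q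
  | state (q : Q) : TapeLetter Γ Q

namespace TapeLetter

variable {Γ Q : Type*}

instance [Finite Γ] [Finite Q] : Finite (TapeLetter Γ Q) :=
  Finite.of_injective (β := Option (Option (Option (Γ ⊕ Q))))
    (fun | leftEnd => none | rightEnd => some none | halted => some (some none)
         | symbol a => some (some (some (.inl a))) | state q => some (some (some (.inr q))))
    (by rintro (_ | _ | _ | a | a) (_ | _ | _ | b | b) h <;> simp_all)

end TapeLetter

open TapeLetter

variable {Γ Q : Type*}

/-- The word that describes a configuration. -/
def tapeWord (ls : List Γ) (q : Q) (rs : List Γ) : List (TapeLetter Γ Q) :=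
  (leftEnd :: ls.reverse.map symbol) ++ state q :: (rs.map symbol ++ [rightEnd])

theorem append_cons_inj {α : Type*} {P : α → Prop} {u v u' v' : List α} {s s' : α}
    (h : u ++ s :: v = u' ++ s' :: v') (hs : P s) (hu' : ∀ a ∈ u', ¬ P a)
    (hv' : ∀ a ∈ v', ¬ P a) : u = u' ∧ s = s' ∧ v = v' := by
  rcases List.append_eq_append_iff.1 h with ⟨c, rfl, h2⟩ | ⟨c, rfl, h2⟩
  · cases c with
    | nil => simpa using h2
    | cons d c =>
      obtain ⟨rfl, -⟩ := List.cons.inj h2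
      exact absurd hs (hu' _ (by simp))
  · cases c with
    | nil => simpa [eq_comm] using h2
    | cons d c =>
      obtain ⟨rfl, rfl⟩ := List.cons.inj h2
      exact absurd hs (hv' _ (by simp))

theorem tapeWord_inj {u v : List (TapeLetter Γ Q)} {q q' : Q} {ls rs : List Γ}
    (h : tapeWord ls q rs = u ++ state q' :: v) :
    u = leftEnd :: ls.reverse.map symbol ∧ q' = q ∧ v = rs.map symbol ++ [rightEnd] := by
  have := append_cons_inj (P := fun a => ∃ q, a = state q) h.symm ⟨q', rfl⟩ (by simp)
    (by rintro a ha ⟨q, rfl⟩; simp at ha)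
  simpa using this

theorem halted_notMem_tapeWord (ls : List Γ) (q : Q) (rs : List Γ) :
    halted ∉ tapeWord ls q rs := by
  simp [tapeWord]

theorem right_of_symbol {rs : List Γ} {a : Γ} {v : List (TapeLetter Γ Q)}
    (h : symbol a :: v = rs.map symbol ++ [rightEnd]) :
    ∃ rs', rs = a :: rs' ∧ v = rs'.map symbol ++ [rightEnd] := by
  cases rs with
  | nil => simp at h
  | cons b rs => simp at h; exact ⟨rs, by simp [h.1], h.2⟩

variable [Inhabited Γ] [Inhabited Q]

/-- The rewriting rules of a Turing machine. -/
inductive MachineRule (M : TM0.Machine Γ Q) :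
    List (TapeLetter Γ Q) × List (TapeLetter Γ Q) → Prop
  | write {q q' : Q} {a b : Γ} (h : M q a = some (q', .write b)) :
      MachineRule M ([state q, symbol a], [state q', symbol b])
  | moveRight {q q' : Q} {a : Γ} (h : M q a = some (q', .move .right)) :
      MachineRule M ([state q, symbol a], [symbol a, state q'])
  | moveLeft {q q' : Q} {a : Γ} (c : Γ) (h : M q a = some (q', .move .left)) :
      MachineRule M ([symbol c, state q, symbol a], [state q', symbol c, symbol a])
  | extendLeft (q : Q) :
      MachineRule M ([leftEnd, state q], [leftEnd, symbol default, state q])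
  | extendRight (q : Q) :
      MachineRule M ([state q, rightEnd], [state q, symbol default, rightEnd])
  | halt {q : Q} {a : Γ} (h : M q a = none) : MachineRule M ([state q, symbol a], [halted])
  | absorbLeft (s : TapeLetter Γ Q) : MachineRule M ([s, halted], [halted])
  | absorbRight (s : TapeLetter Γ Q) : MachineRule M ([halted, s], [halted])

variable {M : TM0.Machine Γ Q}

theorem MachineRule.ne_nil {q : List (TapeLetter Γ Q) × List (TapeLetter Γ Q)}
    (h : MachineRule M q) : q.1 ≠ [] ∧ q.2 ≠ [] := by
  cases h <;> simp

theorem finite_machineRule [Finite Γ] [Finite Q] : {q | MachineRule M q}.Finite := by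
  refine Set.Finite.subset ((List.finite_length_le (TapeLetter Γ Q) 3).prod
    (List.finite_length_le (TapeLetter Γ Q) 3)) ?_
  rintro q h
  cases h <;> simp

/-- The configuration described by a word. -/
def tapeCfg (ls : List Γ) (q : Q) (rs : List Γ) : TM0.Cfg Γ Q :=
  ⟨q, Tape.mk' (ListBlank.mk ls) (ListBlank.mk rs)⟩

/-- Outer blanks are invisible on the tape, so the extension rules change the word but not the
configuration. -/
theorem mk_singleton_default : ListBlank.mk [(default : Γ)] = ListBlank.mk [] :=
  Quotient.sound' (.inr ⟨1, rfl⟩)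

theorem step_tapeCfg_cons (ls : List Γ) (q : Q) (a : Γ) (rs : List Γ) :
    TM0.step M (tapeCfg ls q (a :: rs)) = (M q a).map fun r => ⟨r.1, match r.2 with
      | .move d => (Tape.mk' (ListBlank.mk ls) (ListBlank.mk (a :: rs))).move d
      | .write b => (Tape.mk' (ListBlank.mk ls) (ListBlank.mk (a :: rs))).write b⟩ := by
  simp only [TM0.step, tapeCfg, Tape.mk'_head, ListBlank.head_mk, List.headI_cons]
  rfl

theorem step_write {ls rs : List Γ} {q q' : Q} {a b : Γ} (h : M q a = some (q', .write b)) :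
    TM0.step M (tapeCfg ls q (a :: rs)) = some (tapeCfg ls q' (b :: rs)) := by
  rw [step_tapeCfg_cons, h]
  simp [tapeCfg, Tape.write_mk', ← ListBlank.cons_mk]

theorem step_moveRight {ls rs : List Γ} {q q' : Q} {a : Γ}
    (h : M q a = some (q', .move .right)) :
    TM0.step M (tapeCfg ls q (a :: rs)) = some (tapeCfg (a :: ls) q' rs) := by
  rw [step_tapeCfg_cons, h]
  simp [tapeCfg, Tape.move_right_mk', ← ListBlank.cons_mk]

theorem step_moveLeft {ls rs : List Γ} {q q' : Q} {a c : Γ}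
    (h : M q a = some (q', .move .left)) :
    TM0.step M (tapeCfg (c :: ls) q (a :: rs)) = some (tapeCfg ls q' (c :: a :: rs)) := by
  rw [step_tapeCfg_cons, h]
  simp [tapeCfg, Tape.move_left_mk', ← ListBlank.cons_mk]

theorem step_eq_none_iff {ls rs : List Γ} {q : Q} {a : Γ} :
    TM0.step M (tapeCfg ls q (a :: rs)) = none ↔ M q a = none := by
  rw [step_tapeCfg_cons]
  simp

/-- A configuration word has exactly one state letter, which pins down where a rule applies. Hence
each rewriting is a machine step, an added blank, or a halt; after a halt nothing more has to be
tracked. -/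
theorem reaches_of_rewrites {c : TM0.Cfg Γ Q} {u v : List (TapeLetter Γ Q)}
    (huv : Rewrites {q | MachineRule M q} u v)
    (h : (StateTransition.eval (TM0.step M) c).Dom ∨ ∃ ls q rs, u = tapeWord ls q rs ∧
      StateTransition.Reaches (TM0.step M) c (tapeCfg ls q rs)) :
    (StateTransition.eval (TM0.step M) c).Dom ∨ ∃ ls q rs, v = tapeWord ls q rs ∧
      StateTransition.Reaches (TM0.step M) c (tapeCfg ls q rs) := by
  rcases h with h | ⟨ls, q, rs, rfl, h⟩
  · exact .inl h
  obtain ⟨r, hr, u, w, huv, rfl⟩ := huv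
  have hr' : MachineRule M r := hr
  cases hr' with
  | write hM =>
    obtain ⟨rfl, rfl, h3⟩ := tapeWord_inj (by simpa using huv)
    obtain ⟨rs, rfl, rfl⟩ := right_of_symbol h3
    exact .inr ⟨_, _, _, by simp [tapeWord], h.tail (step_write hM)⟩
  | moveRight hM =>
    obtain ⟨rfl, rfl, h3⟩ := tapeWord_inj (by simpa using huv)
    obtain ⟨rs, rfl, rfl⟩ := right_of_symbol h3
    exact .inr ⟨_, _, _, by simp [tapeWord], h.tail (step_moveRight hM)⟩
  | moveLeft c hM =>
    obtain ⟨h2, rfl, h3⟩ := tapeWord_inj (u := u ++ [symbol c]) (by simpa using huv)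
    obtain ⟨rs, rfl, rfl⟩ := right_of_symbol h3
    cases ls with
    | nil =>
      rw [show leftEnd :: ([] : List Γ).reverse.map symbol = [] ++ [leftEnd (Q := Q)] from rfl] at h2
      simpa using (List.append_inj' h2 rfl).2
    | cons d ls =>
      have h4 : u ++ [symbol c] = (leftEnd :: ls.reverse.map symbol) ++ [symbol d] := by
        simpa using h2
      obtain ⟨rfl, h5⟩ := List.append_inj' h4 rfl
      simp only [List.cons.injEq, symbol.injEq, and_true] at h5
      subst h5
      exact .inr ⟨_, _, _, by simp [tapeWord], h.tail (step_moveLeft hM)⟩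
  | extendLeft q' =>
    obtain ⟨h2, rfl, rfl⟩ := tapeWord_inj (u := u ++ [leftEnd]) (by simpa using huv)
    cases ls with
    | nil =>
      obtain rfl : u = [] := by simpa using h2
      refine .inr ⟨[default], q', rs, by simp [tapeWord], ?_⟩
      rwa [tapeCfg, mk_singleton_default]
    | cons d ls =>
      have h4 : u ++ [leftEnd] = (leftEnd :: ls.reverse.map symbol) ++ [symbol d] := by
        simpa using h2
      simpa using (List.append_inj' h4 rfl).2
  | extendRight q' =>
    obtain ⟨rfl, rfl, h3⟩ := tapeWord_inj (by simpa using huv)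
    cases rs with
    | nil =>
      simp only [List.map_nil, List.nil_append, List.cons.injEq, true_and] at h3
      subst h3
      refine .inr ⟨ls, q', [default], by simp [tapeWord], ?_⟩
      rwa [tapeCfg, mk_singleton_default]
    | cons b rs => simp at h3
  | halt hM =>
    obtain ⟨rfl, rfl, h3⟩ := tapeWord_inj (by simpa using huv)
    obtain ⟨rs, rfl, rfl⟩ := right_of_symbol h3
    refine .inl (Part.dom_iff_mem.2 ⟨_, StateTransition.mem_eval.2 ⟨h, ?_⟩⟩)
    exact step_eq_none_iff.2 hM
  | absorbLeft s =>
    exact absurd (huv ▸ (by simp)) (halted_notMem_tapeWord ls q rs)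
  | absorbRight s =>
    exact absurd (huv ▸ (by simp)) (halted_notMem_tapeWord ls q rs)

theorem dom_of_reaches {ls rs : List Γ} {q : Q}
    (h : Relation.ReflTransGen (Rewrites {q | MachineRule M q}) (tapeWord ls q rs) [halted]) :
    (StateTransition.eval (TM0.step M) (tapeCfg ls q rs)).Dom := by
  have key : ∀ v, Relation.ReflTransGen (Rewrites {q | MachineRule M q}) (tapeWord ls q rs) v →
      (StateTransition.eval (TM0.step M) (tapeCfg ls q rs)).Dom ∨
      ∃ ls' q' rs', v = tapeWord ls' q' rs' ∧
        StateTransition.Reaches (TM0.step M) (tapeCfg ls q rs) (tapeCfg ls' q' rs') := by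
    intro v hv
    induction hv with
    | refl => exact .inr ⟨ls, q, rs, rfl, .refl⟩
    | tail _ huv ih => exact reaches_of_rewrites huv ih
  rcases key _ h with h | ⟨ls', q', rs', h, -⟩
  · exact h
  · exact absurd (h ▸ (by simp)) (halted_notMem_tapeWord ls' q' rs')

theorem Rewrites.of_rule {α : Type*} {R : Set (List α × List α)} {l r : List α} (h : (l, r) ∈ R)
    (a b : List α) : Relation.ReflTransGen (Rewrites R) (a ++ (l ++ b)) (a ++ (r ++ b)) :=
  .single ⟨(l, r), h, a, b, by simp, by simp⟩

/-- There is a description of the same configuration with a scanned cell and a cell on the left of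
it. -/
theorem exists_extension (ls : List Γ) (q : Q) (rs : List Γ) : ∃ c ls' a rs',
    Relation.ReflTransGen (Rewrites {q | MachineRule M q}) (tapeWord ls q rs)
      (tapeWord (c :: ls') q (a :: rs')) ∧
    tapeCfg (c :: ls') q (a :: rs') = tapeCfg ls q rs := by
  have hR : ∃ a rs', Relation.ReflTransGen (Rewrites {q | MachineRule M q}) (tapeWord ls q rs)
      (tapeWord ls q (a :: rs')) ∧ tapeCfg ls q (a :: rs') = tapeCfg ls q rs := by
    cases rs with
    | cons a rs => exact ⟨a, rs, .refl, rfl⟩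
    | nil =>
      refine ⟨default, [], ?_, by rw [tapeCfg, mk_singleton_default]; rfl⟩
      have := Rewrites.of_rule (R := {q | MachineRule M q}) (.extendRight q)
        (leftEnd :: ls.reverse.map symbol) []
      simpa [tapeWord] using this
  obtain ⟨a, rs', h1, h2⟩ := hR
  cases ls with
  | cons c ls => exact ⟨c, ls, a, rs', h1, h2⟩
  | nil =>
    refine ⟨default, [], a, rs', h1.trans ?_, by
      rw [← h2, tapeCfg, mk_singleton_default]; rfl⟩
    have := Rewrites.of_rule (R := {q | MachineRule M q}) (.extendLeft q) []
      ((a :: rs').map symbol ++ [rightEnd])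
    simpa [tapeWord] using this

theorem rewrites_of_step {ls rs : List Γ} {q : Q} {c : TM0.Cfg Γ Q}
    (h : TM0.step M (tapeCfg ls q rs) = some c) : ∃ ls' rs',
    Relation.ReflTransGen (Rewrites {q | MachineRule M q}) (tapeWord ls q rs)
      (tapeWord ls' c.q rs') ∧ tapeCfg ls' c.q rs' = c := by
  obtain ⟨d, ls, a, rs, h1, h2⟩ := exists_extension (M := M) ls q rs
  rw [← h2] at h
  rcases hM : M q a with _ | ⟨q', (_ | _) | b⟩
  · rw [step_eq_none_iff.2 hM] at h
    cases h
  · rw [step_moveLeft hM] at h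
    cases h
    refine ⟨_, _, h1.trans ?_, rfl⟩
    have := Rewrites.of_rule (R := {q | MachineRule M q}) (.moveLeft d hM)
      (leftEnd :: ls.reverse.map symbol) (rs.map symbol ++ [rightEnd])
    simpa [tapeWord, tapeCfg] using this
  · rw [step_moveRight hM] at h
    cases h
    refine ⟨_, _, h1.trans ?_, rfl⟩
    have := Rewrites.of_rule (R := {q | MachineRule M q}) (.moveRight hM)
      (leftEnd :: (d :: ls).reverse.map symbol) (rs.map symbol ++ [rightEnd])
    simpa [tapeWord, tapeCfg] using this
  · rw [step_write hM] at h
    cases h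
    refine ⟨_, _, h1.trans ?_, rfl⟩
    have := Rewrites.of_rule (R := {q | MachineRule M q}) (.write hM)
      (leftEnd :: (d :: ls).reverse.map symbol) (rs.map symbol ++ [rightEnd])
    simpa [tapeWord, tapeCfg] using this

theorem rewrites_halted (u v : List (TapeLetter Γ Q)) :
    Relation.ReflTransGen (Rewrites {q | MachineRule M q}) (u ++ halted :: v) [halted] := by
  induction u using List.reverseRecOn with
  | nil =>
    induction v with
    | nil => exact .refl
    | cons s v ih =>
      have := Rewrites.of_rule (R := {q | MachineRule M q}) (.absorbRight s) [] v
      exact .trans (by simpa using this) ih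
  | append_singleton u s ih =>
    have := Rewrites.of_rule (R := {q | MachineRule M q}) (.absorbLeft s) u v
    exact .trans (by simpa using this) ih

theorem reaches_halted {ls rs : List Γ} {q : Q}
    (h : (StateTransition.eval (TM0.step M) (tapeCfg ls q rs)).Dom) :
    Relation.ReflTransGen (Rewrites {q | MachineRule M q}) (tapeWord ls q rs) [halted] := by
  obtain ⟨c, hc⟩ := Part.dom_iff_mem.1 h
  obtain ⟨hr, hn⟩ := StateTransition.mem_eval.1 hc
  have key : ∃ ls' rs', Relation.ReflTransGen (Rewrites {q | MachineRule M q})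
      (tapeWord ls q rs) (tapeWord ls' c.q rs') ∧ tapeCfg ls' c.q rs' = c := by
    clear hn hc
    induction hr with
    | refl => exact ⟨ls, rs, .refl, rfl⟩
    | tail _ hs ih =>
      obtain ⟨ls1, rs1, h1, h2⟩ := ih
      rw [← h2] at hs
      obtain ⟨ls2, rs2, h3, h4⟩ := rewrites_of_step hs
      exact ⟨ls2, rs2, h1.trans h3, h4⟩
  obtain ⟨ls1, rs1, h1, h2⟩ := key
  -- The halting rule needs an explicit scanned symbol.
  obtain ⟨d, ls2, a, rs2, h3, h4⟩ := exists_extension (M := M) ls1 c.q rs1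
  rw [← h2, ← h4, step_eq_none_iff] at hn
  refine (h1.trans h3).trans (.trans ?_ (rewrites_halted
    (leftEnd :: (d :: ls2).reverse.map symbol) (rs2.map symbol ++ [rightEnd])))
  have := Rewrites.of_rule (R := {q | MachineRule M q}) (.halt hn)
    (leftEnd :: (d :: ls2).reverse.map symbol) (rs2.map symbol ++ [rightEnd])
  simpa [tapeWord] using this

theorem reaches_halted_iff {l : List Γ} :
    Relation.ReflTransGen (Rewrites {q | MachineRule M q}) (tapeWord [] default l) [halted] ↔
      (TM0.eval M l).Dom :=
  ⟨dom_of_reaches, reaches_halted⟩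

end TuringMachine

open Turing

/-! ### A Turing machine with an undecidable halting problem -/

section Universal

/-- States outside the supporting set are never reached, so they may be collapsed to the default
state. -/
theorem exists_finite_machine {Γ Λ : Type} [Inhabited Γ] [Inhabited Λ] (M : TM0.Machine Γ Λ)
    {S : Set Λ} (hS : S.Finite) (ss : TM0.Supports M S) :
    ∃ (Q : Type) (_ : Inhabited Q) (_ : Finite Q) (M' : TM0.Machine Γ Q),
      ∀ l, (TM0.eval M' l).Dom ↔ (TM0.eval M l).Dom := by
  classical
  let _ : Inhabited S := ⟨⟨default, ss.1⟩⟩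
  let f : PointedMap Γ Γ := ⟨id, rfl⟩
  let g : PointedMap Λ S := ⟨fun q => if h : q ∈ S then ⟨q, h⟩ else default, by
    rw [dif_pos ss.1]; rfl⟩
  refine ⟨S, inferInstance, hS, M.map f f g Subtype.val, fun l => ?_⟩
  have hr := TM0.Machine.map_respects M f f g Subtype.val ss (fun _ => rfl) (fun q hq => by
    have h : g q = ⟨q, hq⟩ := dif_pos hq
    exact congrArg Subtype.val h)
  refine StateTransition.tr_eval_dom (a₁ := TM0.init l) (a₂ := TM0.init l) hr ⟨ss.1, ?_⟩
  rw [TM0.map_init]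
  exact congrArg _ (List.map_id l)

/-- The digits `0` and `1` on the stacks of the machine of a recursive function. -/
def digit (b : Bool) : PartrecToTM2.Γ' := cond b .bit1 .bit0

theorem trPosNum_eq_bits (n : PosNum) :
    PartrecToTM2.trPosNum n = (n : ℕ).bits.map digit := by
  induction n with
  | one => simp [PartrecToTM2.trPosNum, digit]
  | bit0 n ih =>
    have h : (n : ℕ) ≠ 0 := (PosNum.cast_pos n).ne'
    rw [PosNum.cast_bit0, ← two_mul, Nat.bit0_bits _ h, PartrecToTM2.trPosNum, ih]
    rfl
  | bit1 n ih =>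
    rw [PosNum.cast_bit1, ← two_mul, Nat.bit1_bits, PartrecToTM2.trPosNum, ih]
    rfl

theorem trNat_eq_bits (n : ℕ) : PartrecToTM2.trNat n = n.bits.map digit := by
  rw [PartrecToTM2.trNat]
  conv_rhs => rw [← Num.to_of_nat n]
  cases (n : Num) with
  | zero => rfl
  | pos p => exact trPosNum_eq_bits p

theorem bits_eq_cons {n : ℕ} (hn : n ≠ 0) : n.bits = n.bodd :: (n / 2).bits := by
  rcases Nat.even_or_odd' n with ⟨k, rfl | rfl⟩
  · rw [Nat.bit0_bits k (by omega)]
    simp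
  · rw [Nat.bit1_bits, show (2 * k + 1) / 2 = k by omega]
    simp

theorem primrec_bits : Primrec Nat.bits := by
  have : Primrec₂ fun (_ : Unit) (n : ℕ) => n.bits := by
    -- The list `l` holds the values below `n`, so its length is `n` and entry `n / 2` gives the
    -- remaining bits.
    refine Primrec.nat_strong_rec _ (g := fun _ l => bif l.length == 0 then some [] else
      (l[l.length / 2]?).map fun t => l.length.bodd :: t) ?_ ?_
    · have hl : Primrec fun q : Unit × List (List Bool) => q.2.length :=
        Primrec.list_length.comp .snd
      refine Primrec.cond (Primrec.beq.comp hl (.const 0)) (.const _) ?_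
      refine Primrec.option_map (Primrec.list_getElem?.comp .snd
        (Primrec.nat_div.comp hl (.const 2))) ?_
      exact Primrec.list_cons.comp (Primrec.nat_bodd.comp (hl.comp .fst)) .snd
    · intro _ n
      rcases eq_or_ne n 0 with rfl | hn
      · simp
      · have h2 : n / 2 < n := by omega
        have h0 : (n == 0) = false := by simpa using hn
        simp [h0, h2, bits_eq_cons hn]
  exact this.comp (.const ()) .id

/-- The code is universal: it runs the program with number `n` on input `0`. -/
theorem exists_code_of_undecidable :
    ∃ c : ToPartrec.Code, ¬ ComputablePred fun n : ℕ => (c.eval [n]).Dom := by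
  let f : ℕ →. ℕ := fun n => (Denumerable.ofNat Nat.Partrec.Code n).eval 0
  have hf : Partrec f :=
    Nat.Partrec.Code.eval_part.comp (Computable.ofNat _) (Computable.const 0)
  obtain ⟨c, hc⟩ := ToPartrec.Code.exists_code (Nat.Partrec'.part_iff₁.2 hf)
  refine ⟨c, fun ⟨_, h⟩ => ComputablePred.halting_problem 0 ?_⟩
  have hd : ∀ a : Nat.Partrec.Code, (c.eval [Encodable.encode a]).Dom ↔ (a.eval 0).Dom := by
    intro a
    have := hc ⟨[Encodable.encode a], rfl⟩
    change c.eval [Encodable.encode a] = pure <$> f (Encodable.encode a) at this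
    rw [this]
    simp [f]
  classical
  refine ⟨inferInstance, (h.comp Computable.encode).of_eq fun a => ?_⟩
  exact decide_eq_decide.2 (hd a)

/-- The universal code is compiled to a stack machine and then to a one-tape machine with finite
support. The input word is kept explicit so that it depends computably on `n`. -/
theorem exists_undecidable_machine :
    ∃ (Γ Q : Type) (_ : Inhabited Γ) (_ : Inhabited Q) (_ : Finite Γ) (_ : Finite Q)
      (M : TM0.Machine Γ Q) (a : Γ) (g : Bool → Γ),
      ¬ ComputablePred fun n : ℕ => (TM0.eval M (a :: n.bits.reverse.map g)).Dom := by
  obtain ⟨c, hc⟩ := exists_code_of_undecidable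
  let _ : Inhabited PartrecToTM2.Λ' := ⟨PartrecToTM2.trNormal c .halt⟩
  let _ : Fintype PartrecToTM2.K' := ⟨{.main, .rev, .aux, .stack}, by
    rintro (_ | _ | _ | _) <;> simp⟩
  have hfin : Finite (TM2to1.Γ' PartrecToTM2.K' fun _ => PartrecToTM2.Γ') := Finite.of_fintype _
  have s2 : TM2.Supports PartrecToTM2.tr (PartrecToTM2.codeSupp c .halt) :=
    PartrecToTM2.tr_supports c .halt
  have s1 := TM2to1.tr_supports _ s2
  have s0 := TM1to0.tr_supports _ s1
  obtain ⟨Q, hQ, hQ', M, hM⟩ := exists_finite_machine _ (Finset.finite_toSet _) s0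
  -- The flag `true` marks the bottom of the stacks. The main stack is written from the bottom up,
  -- so the separator comes first and the bits follow in reverse.
  let a : TM2to1.Γ' PartrecToTM2.K' fun _ => PartrecToTM2.Γ' :=
    (true, Function.update (fun _ => none) .main (some .cons))
  let g : Bool → TM2to1.Γ' PartrecToTM2.K' fun _ => PartrecToTM2.Γ' :=
    fun b => (false, Function.update (fun _ => none) .main (some (digit b)))
  refine ⟨_, Q, inferInstance, hQ, hfin, hQ', M, a, g, ?_⟩
  convert hc using 3 with n
  rw [hM, TM1to0.tr_eval]
  have h0 : (PartrecToTM2.trList [n]).reverse = .cons :: n.bits.reverse.map digit := by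
    simp [PartrecToTM2.trList, trNat_eq_bits]
  have h1 : TM2to1.trInit .main (PartrecToTM2.trList [n]) = a :: n.bits.reverse.map g := by
    unfold TM2to1.trInit
    rw [h0]
    exact congrArg (List.cons a) List.map_map
  have h4 := TM2to1.tr_eval_dom PartrecToTM2.tr .main (PartrecToTM2.trList [n])
  rw [h1] at h4
  refine h4.trans ?_
  have h2 : (TM2.init .main (PartrecToTM2.trList [n]) : PartrecToTM2.Cfg') =
      PartrecToTM2.init c [n] := by
    simp only [TM2.init, PartrecToTM2.init]
    congr 1
    funext k
    cases k <;> rfl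
  have h3 := PartrecToTM2.tr_eval c [n]
  rw [← h2] at h3
  change (StateTransition.eval (TM2.step PartrecToTM2.tr)
    (TM2.init .main (PartrecToTM2.trList [n]))).Dom ↔ _
  rw [h3]
  simp

end Universal

/-! ### The reduction -/

open Formula

theorem vars_arrow (i : ℕ) (A : Formula) : (arrow i A).vars = A.vars := by
  induction i with
  | zero => simp [arrow, vars]
  | succ i ih => simp [arrow, vars, ih]

theorem vars_letterCode (a : Fin m) (F : Formula) : (letterCode a F).vars = F.vars ∪ {2} := by
  simp [letterCode, vars, vars_arrow, p]

theorem vars_wordCode {w : List (Fin m)} (hw : w ≠ []) (F : Formula) :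
    (wordCode w F).vars = F.vars ∪ {2} := by
  induction w with
  | nil => exact absurd rfl hw
  | cons a w ih =>
    cases w with
    | nil => simp [wordCode, vars_letterCode]
    | cons b w => rw [wordCode, vars_letterCode, ih (by simp)]; simp

theorem PostInstance.vars_calculus {I : PostInstance m} (hI : I.pairs ≠ []) :
    I.calculus.vars = {0, 1, 2} := by
  have hpair : ∀ q ∈ I.pairs,
      (imp (imp (wordCode q.1 x) (wordCode q.2 y)) (imp x y)).vars = {0, 1, 2} := by
    intro q hq
    obtain ⟨h1, h2⟩ := I.nonempty q hq
    simp only [vars, vars_wordCode h1, vars_wordCode h2, x, y]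
    decide
  apply Finset.Subset.antisymm
  · refine Finset.biUnion_subset.2 fun A hA => ?_
    rcases I.mem_calculus.1 hA with ⟨a, rfl⟩ | ⟨q, hq, rfl⟩ | ⟨a, rfl⟩
    · simp only [vars_letterCode, x, vars]; decide
    · exact (hpair q hq).subset
    · simp only [vars, vars_letterCode, x]; decide
  · obtain ⟨q, hq⟩ := List.exists_mem_of_ne_nil _ hI
    rw [← hpair q hq]
    exact Finset.subset_biUnion_of_mem vars (I.mem_calculus.2 (.inr (.inl ⟨q, hq, rfl⟩)))

/-! ### Computability of the reduction -/

theorem primrec_imp : Primrec₂ imp := by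
  have h : Primrec fun q : Formula × Formula =>
      2 * Nat.pair (Encodable.encode q.1) (Encodable.encode q.2) + 1 :=
    Primrec.succ.comp (Primrec.nat_mul.comp (.const 2)
      (Primrec₂.natPair.comp (Primrec.encode.comp .fst) (Primrec.encode.comp .snd)))
  exact Primrec.encode_iff.1 (h.of_eq fun q => rfl)

theorem primrec_wordCode (F : Formula) : Primrec fun w : List (Fin m) => wordCode w F := by
  have h : Primrec₂ fun (_ : List (Fin m)) (q : Fin m × Formula) => letterCode q.1 q.2 :=
    primrec_imp.comp (Primrec.snd.comp .snd) ((Primrec.dom_finite fun a : Fin m =>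
      imp (arrow (a.val + 1) p) (imp p p)).comp (Primrec.fst.comp .snd))
  refine (Primrec.list_foldr .id (.const F) h).of_eq fun w => ?_
  induction w with
  | nil => rfl
  | cons a w ih => simp only [id] at ih ⊢; rw [List.foldr_cons, ih]; rfl

theorem exists_undecidable_system {z o : Fin m} (hzo : z ≠ o) :
    ∃ S : Set (List (Fin m) × List (Fin m)), S.Finite ∧ S.Nonempty ∧
      (∀ q ∈ S, q.1 ≠ [] ∧ q.2 ≠ []) ∧ NoOverhang S ∧
      ∃ (u : List (Fin m)) (v : ℕ → List (Fin m)), u ≠ [] ∧ (∀ n, v n ≠ []) ∧ Primrec v ∧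
        ¬ ComputablePred fun n => Joins S u (v n) := by
  obtain ⟨Γ, Q, _, _, _, _, M, a, g, hM⟩ := exists_undecidable_machine
  obtain ⟨e, he⟩ := exists_injective_nat (Signed (TapeLetter Γ Q))
  let f : Signed (TapeLetter Γ Q) → List (Fin m) := fun s => List.replicate (e s) z ++ [o]
  have hf : IsPrefixCode f := isPrefixCode_replicate hzo he
  have hne : ∀ s, f s ≠ [] := by simp [f]
  have hmap : ∀ w : List (Signed (TapeLetter Γ Q)), w ≠ [] → w.flatMap f ≠ [] := by
    intro w hw
    obtain ⟨s, w, rfl⟩ := List.exists_cons_of_ne_nil hw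
    simp [hne]
  let R : Set (List (TapeLetter Γ Q) × List (TapeLetter Γ Q)) := {q | MachineRule M q}
  have hR : ∀ q ∈ R, q.1 ≠ [] ∧ q.2 ≠ [] := fun q hq => MachineRule.ne_nil hq
  let W : ℕ → List (Signed (TapeLetter Γ Q)) := fun n => Signed.post (.bar ::
    (tapeWord [] (default : Q) (a :: n.bits.reverse.map g)).map .letter)
  refine ⟨codePair f '' {q | StarPair R .halted q},
    (finite_starPair finite_machineRule).image _, ⟨_, _, .bar, rfl⟩, ?_,
    (noOverhang_starPair hR).image hf hne, [Signed.star].flatMap f, fun n => (W n).flatMap f,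
    hmap _ (by simp), fun n => hmap _ (by simp [W, Signed.post]), ?_, ?_⟩
  · rintro _ ⟨q, hq, rfl⟩
    exact ⟨hmap _ (StarPair.ne_nil hR hq).1, hmap _ (StarPair.ne_nil hR hq).2⟩
  -- Only the middle block depends on `n`; the blocks around it are constant.
  · let u₁ := (Signed.post [.bar, .letter .leftEnd, .letter (.state (default : Q)),
      .letter (.symbol a)]).flatMap f
    let u₂ := (Signed.post [.letter (.rightEnd : TapeLetter Γ Q)]).flatMap f
    let h : Bool → List (Fin m) := fun b => (Signed.post [.letter (.symbol (g b))]).flatMap f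
    have hp : Primrec fun n : ℕ => u₁ ++ (n.bits.reverse.flatMap h ++ u₂) :=
      Primrec.list_append.comp (.const u₁) (Primrec.list_append.comp
        (Primrec.list_flatMap (Primrec.list_reverse.comp primrec_bits)
          ((Primrec.dom_finite h).comp .snd)) (.const u₂))
    refine hp.of_eq fun n => ?_
    simp [u₁, u₂, h, W, Signed.post, tapeWord, List.flatMap_assoc]
    rw [← List.map_reverse, List.flatMap_map]
    rfl
  · convert hM using 3 with n
    rw [joins_image_iff hf hne, joins_starPair_iff, reaches_halted_iff]

theorem ComputablePred.of_comp_primrec {α β : Type*} [Primcodable α] [Primcodable β]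
    {P : β → Prop} (h : ComputablePred P) {f : α → β} (hf : Primrec f) :
    ComputablePred fun a => P (f a) := by
  obtain ⟨_, h⟩ := h
  exact ⟨inferInstance, h.comp hf.to_comp⟩

end IterCalc

theorem mainTheorem1 (m : ℕ) (hm : 2 ≤ m) :
    ∃ I : IterCalc.PostInstance m,
      I.calculus.vars.card = 3 ∧
      ¬ I.calculus.IsDecidable ∧
      ¬ I.calculus.IsWeaklyDecidable := by
  open IterCalc in
  obtain ⟨S, hfin, hS, hne, hover, u, v, hu, hv, hprim, hund⟩ :=
    exists_undecidable_system (m := m) (z := ⟨0, by omega⟩) (o := ⟨1, by omega⟩) (by simp)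
  obtain ⟨I, rfl⟩ : ∃ I : PostInstance m, I.system = S :=
    ⟨⟨hfin.toFinset.toList, by simpa using fun a b => hne (a, b)⟩, by
      ext q; simp [PostInstance.system]⟩
  have hf : Primrec fun n => Formula.imp (wordCode u x) (wordCode (v n) x) :=
    primrec_imp.comp (.const _) ((primrec_wordCode x).comp hprim)
  refine ⟨I, ?_, fun h => hund ?_, fun h => hund ?_⟩
  · obtain ⟨q, hq⟩ := hS
    rw [PostInstance.vars_calculus (List.ne_nil_of_mem hq)]
    rfl
  · convert ComputablePred.of_comp_primrec h hf using 2 with n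
    rw [PostInstance.derivable_iff_joins hover hu (hv n)]
  · convert ComputablePred.of_comp_primrec h hf using 2 with n
    rw [PostInstance.weaklyDerivable_iff_joins hover hu (hv n)]
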